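/- Let $N\ge 1$ be an integer, let $1<p<\infty$, and let $-\widetilde\Delta_p$ be minus the normalized $p$-Laplacian on $\mathbb{R}^N$, \[ -\widetilde\Delta_p u=-\frac1p|Du|^{2-p}\,\mathrm{div}\big(|Du|^{p-2}Du\big)=-\mathrm{Tr}\big(A_p(Du)D^2u\big),\qquad A_p(\xi)=\frac1p\Big(I_N+(p-2)\frac{\xi\otimes \xi}{|\xi|^2}\Big)\quad(\xi\ne0). \] Let $b:\mathbb{R}^N\to\mathbb{R}^N$ be Lipschitz continuous on every ball $\{|x|\le R\}$, $R>0$, and suppose that \[ \limsup_{|x|\to\infty} b(x)\cdot x<\begin{cases}1-\dfrac{N(p-1)}{p}&\text{if } p>2,\\[2mm] 1-\dfrac Np&\text{if } 1<p\le 2\end{cases} \] (the value $-\infty$ being allowed for the $\limsup$). Let either $A>0$ and $\gamma>0$, or $A\in\mathbb{R}$ and $\gamma=2$. Let $u:\mathbb{R}^N\to\mathbb{R}$ be bounded from below and satisfy \[ -\widetilde\Delta_p u-b(x)\cdot Du\ \ge\ A|Du|^\gamma\qquad\text{in }\mathbb{R}^N \] in the viscosity sense, that is: $u$ is lower semicontinuous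 and, whenever $\varphi\in C^2(\mathbb{R}^N)$ and $u-\varphi$ has a local minimum at $x$, one has \[ F^*\big(D\varphi(x),D^2\varphi(x)\big)-b(x)\cdot D\varphi(x)\ \ge\ A|D\varphi(x)|^\gamma , \] where $F^*$ is the upper semicontinuous envelope of $(\xi,X)\mapsto-\mathrm{Tr}(A_p(\xi)X)$, i.e. $F^*(\xi,X)=-\mathrm{Tr}(A_p(\xi)X)$ for $\xi\neq0$ and $F^*(0,X)=\max_{|\nu|=1}\big(-\mathrm{Tr}(A_p(\nu)X)\big)$. Then $u$ is constant. -/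

import Mathlib

open scoped NNReal

noncomputable section

/-- The coefficient matrix `A(ξ) = (1/p) (I + (p - 2) (ξ ⊗ ξ) / |ξ|²)` of the normalized
`p`-Laplacian, meaningful for `ξ ≠ 0`. -/
def normPLapCoeff {N : ℕ} (p : ℝ) (ξ : EuclideanSpace ℝ (Fin N)) : Matrix (Fin N) (Fin N) ℝ :=
  (1 / p) • ((1 : Matrix (Fin N) (Fin N) ℝ) +
    ((p - 2) / ‖ξ‖ ^ 2) • Matrix.vecMulVec (fun i => ξ i) (fun i => ξ i))

/-- `F(ξ, X) = - Tr (A(ξ) X)`: for `ξ = Du ≠ 0` and `X = D²u` this is the negative normalized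
`p`-Laplacian of `u`. -/
def negNormPLap {N : ℕ} (p : ℝ) (ξ : EuclideanSpace ℝ (Fin N))
    (X : Matrix (Fin N) (Fin N) ℝ) : ℝ :=
  -(normPLapCoeff p ξ * X).trace

open scoped Classical in
/-- The upper semicontinuous envelope of `F(ξ, X) = - Tr (A(ξ) X)`, as used for viscosity
supersolutions of an equation that is singular at `ξ = 0`. `F` is continuous off `ξ = 0`, where it
is its own envelope. As `F(ξ, X)` depends on `ξ ≠ 0` only through `ξ / |ξ|`, the
envelope at `ξ = 0` is the supremum (a maximum) over all unit vectors. -/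
def negNormPLapUpper {N : ℕ} (p : ℝ) (ξ : EuclideanSpace ℝ (Fin N))
    (X : Matrix (Fin N) (Fin N) ℝ) : ℝ :=
  if ξ = 0 then
    ⨆ ν : Metric.sphere (0 : EuclideanSpace ℝ (Fin N)) 1, negNormPLap p ν.1 X
  else negNormPLap p ξ X

/-- The Hessian matrix `D²φ(x)` in the standard basis. -/
def hessianMatrix {N : ℕ} (φ : EuclideanSpace ℝ (Fin N) → ℝ) (x : EuclideanSpace ℝ (Fin N)) :
    Matrix (Fin N) (Fin N) ℝ :=
  Matrix.of fun i j =>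
    fderiv ℝ (fderiv ℝ φ) x (EuclideanSpace.single i 1) (EuclideanSpace.single j 1)

/-- `u` satisfies `-Δ̃_p u - b(x) · Du ≥ A |Du|^γ` in `ℝ^N` in the viscosity sense: `u` is lower
semicontinuous, and whenever a `C²` function `φ` touches `u` from below at `x` (up to an additive
constant), the inequality holds for `φ` at `x`, with the operator replaced by its upper
semicontinuous envelope. -/
structure IsViscositySupersolutionNormPLap {N : ℕ} (p : ℝ)
    (b : EuclideanSpace ℝ (Fin N) → EuclideanSpace ℝ (Fin N)) (A γ : ℝ)
    (u : EuclideanSpace ℝ (Fin N) → ℝ) : Prop where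
  lowerSemicontinuous : LowerSemicontinuous u
  test : ∀ (x : EuclideanSpace ℝ (Fin N)) (φ : EuclideanSpace ℝ (Fin N) → ℝ),
    ContDiff ℝ 2 φ → IsLocalMin (fun y => u y - φ y) x →
      A * ‖gradient φ x‖ ^ γ ≤
        negNormPLapUpper p (gradient φ x) (hessianMatrix φ x) - inner ℝ (b x) (gradient φ x)

end

/-! Both alternatives for `A`, `γ` give `A r^γ ≥ -|A| r²`, so `u` is a supersolution with an at most
quadratic negative gradient term, which small multiples of a barrier absorb. Attainment of the
infimum (`exists_forall_le`): outside a large ball the drift condition makes `-(ε/2) log(1 + |x|²)`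
violate the inequality, so the minimum of `u + (ε/2) log(1 + |x|²)` lies in that ball; let `ε → 0`.
Strong minimum principle (`eq_of_forall_le`): a Hopf barrier `δ exp(-α|x - y|²)` on the largest ball
about `y` missing the minimum set gives a contradiction. Both barriers are radial and are tested
only where their gradient is nonzero, so the envelope at `ξ = 0` never enters. -/

section RadialTestFunctions

variable {N : ℕ}

/-- The value of the operator at `ξ = t z`, `X = a z ⊗ z + c I`. -/
lemma negNormPLap_radial {p t a c : ℝ} {z : EuclideanSpace ℝ (Fin N)} (ht : t ≠ 0) (hz : z ≠ 0) :
    negNormPLap p (t • z)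
        (Matrix.of fun i j => a * (z i * z j) + c * (1 : Matrix (Fin N) (Fin N) ℝ) i j) =
      -(1 / p) * ((p - 1) * a * ‖z‖ ^ 2 + c * (N + p - 2)) := by
  have hs : ∑ i, z i * z i = ‖z‖ ^ 2 := by
    rw [EuclideanSpace.real_norm_sq_eq]
    exact Finset.sum_congr rfl fun i _ => (sq (z i)).symm
  have hz' : ‖z‖ ≠ 0 := norm_ne_zero_iff.2 hz
  have hX : (Matrix.of fun i j => a * (z i * z j) + c * (1 : Matrix (Fin N) (Fin N) ℝ) i j) =
      a • Matrix.vecMulVec (fun i => z i) (fun i => z i) + c • 1 := by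
    ext i j
    simp [Matrix.vecMulVec_apply]
  have hV : Matrix.vecMulVec (fun i => (t • z) i) (fun i => (t • z) i) =
      (t ^ 2) • Matrix.vecMulVec (fun i => z i) (fun i => z i) := by
    ext i j
    simp [Matrix.vecMulVec_apply]
    ring
  have htr : (Matrix.vecMulVec (fun i => z i) (fun i => z i)).trace = ‖z‖ ^ 2 := by
    simpa [Matrix.trace, Matrix.vecMulVec_apply] using hs
  have hVV : Matrix.vecMulVec (fun i => z i) (fun i => z i) *
      Matrix.vecMulVec (fun i => z i) (fun i => z i) =
      (‖z‖ ^ 2) • Matrix.vecMulVec (fun i => z i) (fun i => z i) := by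
    rw [Matrix.vecMulVec_mul_vecMulVec]
    ext i j
    simp only [Matrix.vecMulVec_apply, Matrix.smul_apply, dotProduct, hs, smul_eq_mul,
      Pi.smul_apply]
    ring
  rw [negNormPLap, normPLapCoeff, hX, hV]
  simp only [Matrix.smul_mul, Matrix.mul_add, Matrix.add_mul, Matrix.mul_smul, Matrix.mul_one,
    Matrix.one_mul, Matrix.trace_smul, Matrix.trace_add, Matrix.trace_one, hVV, htr,
    smul_eq_mul, Fintype.card_fin, norm_smul, mul_pow, Real.norm_eq_abs, sq_abs]
  field_simp
  ring

variable {f f₁ f₂ : ℝ → ℝ} {x y : EuclideanSpace ℝ (Fin N)}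

/-- Derivatives of the profile are required only for `s ≥ 0`, since `log (1 + s)` is singular at `s
= -1`. -/
lemma hasFDerivAt_radial (hf : ∀ s, 0 ≤ s → HasDerivAt f (f₁ s) s)
    (x y : EuclideanSpace ℝ (Fin N)) :
    HasFDerivAt (fun x => f (‖x - y‖ ^ 2))
      ((2 * f₁ (‖x - y‖ ^ 2)) • innerSL ℝ (x - y)) x := by
  have h := (hf _ (sq_nonneg ‖x - y‖)).comp_hasFDerivAt x
    ((hasFDerivAt_id x).sub_const y).norm_sq
  refine h.congr_fderiv ?_
  ext v
  simp
  ring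

lemma gradient_radial (hf : ∀ s, 0 ≤ s → HasDerivAt f (f₁ s) s)
    (x y : EuclideanSpace ℝ (Fin N)) :
    gradient (fun x => f (‖x - y‖ ^ 2)) x = (2 * f₁ (‖x - y‖ ^ 2)) • (x - y) := by
  apply HasGradientAt.gradient
  rw [hasGradientAt_iff_hasFDerivAt]
  refine (hasFDerivAt_radial hf x y).congr_fderiv ?_
  ext v
  simp

lemma hessianMatrix_radial (hf : ∀ s, 0 ≤ s → HasDerivAt f (f₁ s) s)
    (hf₁ : ∀ s, 0 ≤ s → HasDerivAt f₁ (f₂ s) s) (x y : EuclideanSpace ℝ (Fin N)) :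
    hessianMatrix (fun x => f (‖x - y‖ ^ 2)) x =
      Matrix.of fun i j => (4 * f₂ (‖x - y‖ ^ 2)) * ((x - y) i * (x - y) j) +
        (2 * f₁ (‖x - y‖ ^ 2)) * (1 : Matrix (Fin N) (Fin N) ℝ) i j := by
  have h₁ : fderiv ℝ (fun x => f (‖x - y‖ ^ 2)) =
      fun x => (2 * f₁ (‖x - y‖ ^ 2)) • innerSL ℝ (x - y) :=
    funext fun x => (hasFDerivAt_radial hf x y).fderiv
  have h₂ : HasFDerivAt (fun x => (2 * f₁ (‖x - y‖ ^ 2)) • innerSL ℝ (x - y)) _ x :=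
    ((hasFDerivAt_radial hf₁ x y).const_mul 2).smul
      (((innerSL ℝ (E := EuclideanSpace ℝ (Fin N))).hasFDerivAt (x := x - y)).comp x
        ((hasFDerivAt_id x).sub_const y))
  ext i j
  rw [hessianMatrix, h₁, Matrix.of_apply, Matrix.of_apply, h₂.fderiv]
  have hsingle (k l : Fin N) : (EuclideanSpace.single k (1 : ℝ)) l =
      (1 : Matrix (Fin N) (Fin N) ℝ) k l := by
    simp [Matrix.one_apply, eq_comm]
  have hinner (v : EuclideanSpace ℝ (Fin N)) (k : Fin N) :
      innerSL ℝ v (EuclideanSpace.single k 1) = v k := by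
    rw [innerSL_apply_apply, EuclideanSpace.inner_single_right]
    simp
  simp only [add_apply, smul_apply, ContinuousLinearMap.comp_apply,
    ContinuousLinearMap.smulRight_apply, ContinuousLinearMap.id_apply, hinner, hsingle,
    smul_eq_mul]
  ring

/-- The viscosity inequality for a radial test function, away from its centre. -/
lemma IsViscositySupersolutionNormPLap.radial_test {p A γ K : ℝ}
    {b : EuclideanSpace ℝ (Fin N) → EuclideanSpace ℝ (Fin N)} {u : EuclideanSpace ℝ (Fin N) → ℝ}
    (hu : IsViscositySupersolutionNormPLap p b A γ u)
    (hK : ∀ r : ℝ, 0 ≤ r → -(K * r ^ 2) ≤ A * r ^ γ)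
    (hf : ∀ s, 0 ≤ s → HasDerivAt f (f₁ s) s) (hf₁ : ∀ s, 0 ≤ s → HasDerivAt f₁ (f₂ s) s)
    (hC : ContDiff ℝ 2 fun x : EuclideanSpace ℝ (Fin N) => f (‖x - y‖ ^ 2))
    (hxy : x ≠ y) (hne : f₁ (‖x - y‖ ^ 2) ≠ 0)
    (hmin : IsLocalMin (fun x => u x - f (‖x - y‖ ^ 2)) x) :
    -(K * (4 * f₁ (‖x - y‖ ^ 2) ^ 2 * ‖x - y‖ ^ 2)) ≤
      -(1 / p) * (4 * (p - 1) * f₂ (‖x - y‖ ^ 2) * ‖x - y‖ ^ 2 +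
        2 * f₁ (‖x - y‖ ^ 2) * (N + p - 2)) - 2 * f₁ (‖x - y‖ ^ 2) * inner ℝ (b x) (x - y) := by
  have hz : x - y ≠ 0 := sub_ne_zero.2 hxy
  have ht : 2 * f₁ (‖x - y‖ ^ 2) ≠ 0 := mul_ne_zero two_ne_zero hne
  have h := hu.test x _ hC hmin
  rw [gradient_radial hf, hessianMatrix_radial hf hf₁, negNormPLapUpper,
    if_neg (smul_ne_zero ht hz), negNormPLap_radial ht hz, real_inner_smul_right] at h
  have h' := (hK _ (norm_nonneg ((2 * f₁ (‖x - y‖ ^ 2)) • (x - y)))).trans h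
  rw [norm_smul, mul_pow, Real.norm_eq_abs, sq_abs] at h'
  linarith

end RadialTestFunctions

/-! ### Attainment of the infimum: logarithmic barrier. -/

section Liouville

variable {N : ℕ} {p A γ K : ℝ} {b : EuclideanSpace ℝ (Fin N) → EuclideanSpace ℝ (Fin N)}
  {u : EuclideanSpace ℝ (Fin N) → ℝ}

/-- After multiplication by `(1 + |x|²)/ε`, diffusion contributes `-(1 - N/p)` plus a decaying term
and the gradient term costs at most `K ε < c`, contradicting the margin `c` in the drift bound. -/
lemma IsViscositySupersolutionNormPLap.not_isLocalMin_add_log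
    (hu : IsViscositySupersolutionNormPLap p b A γ u) (hp : 1 < p)
    (hK0 : 0 ≤ K) (hK : ∀ r : ℝ, 0 ≤ r → -(K * r ^ 2) ≤ A * r ^ γ)
    {c ε : ℝ} (hε : 0 < ε) (hεK : K * ε < c) {x : EuclideanSpace ℝ (Fin N)} (hx : x ≠ 0)
    (hb : inner ℝ (b x) x + 2 * (p - 1) / (p * (1 + ‖x‖ ^ 2)) ≤ 1 - N / p - c) :
    ¬ IsLocalMin (fun x => u x - -(ε / 2) * Real.log (1 + ‖x‖ ^ 2)) x := by
  intro hmin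
  have hf : ∀ s : ℝ, 0 ≤ s →
      HasDerivAt (fun s => -(ε / 2) * Real.log (1 + s)) (-(ε / 2) * (1 + s)⁻¹) s := by
    intro s hs
    have h := (((hasDerivAt_id s).const_add 1).log (by simp; positivity)).const_mul (-(ε / 2))
    simpa using h
  have hf₁ : ∀ s : ℝ, 0 ≤ s →
      HasDerivAt (fun s => -(ε / 2) * (1 + s)⁻¹) ((ε / 2) * ((1 + s) ^ 2)⁻¹) s := by
    intro s hs
    have h := (((hasDerivAt_id s).const_add 1).inv (by simp; positivity)).const_mul (-(ε / 2))
    refine h.congr_deriv ?_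
    simp
    ring
  have hC : ContDiff ℝ 2 fun x : EuclideanSpace ℝ (Fin N) =>
      -(ε / 2) * Real.log (1 + ‖x - 0‖ ^ 2) := by
    refine contDiff_const.mul (ContDiff.log ?_ fun x => by positivity)
    exact contDiff_const.add ((contDiff_id.sub contDiff_const).norm_sq ℝ)
  have h := hu.radial_test (x := x) (y := 0) hK hf hf₁ hC hx
    (mul_ne_zero (by simpa using hε.ne') (by positivity)) (by simpa using hmin)
  simp only [sub_zero] at h
  set s := ‖x‖ ^ 2
  have hs : 0 ≤ s := sq_nonneg _
  have hs1 : 0 < 1 + s := by positivity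
  have hp0 : 0 < p := by linarith
  have key : -(K * ε * (s / (1 + s))) ≤
      -(1 / p) * (2 * (p - 1) * (s / (1 + s)) - (N + p - 2)) + inner ℝ (b x) x := by
    have h' := mul_le_mul_of_nonneg_left h (by positivity : 0 ≤ (1 + s) / ε)
    have e1 : (1 + s) / ε * -(K * (4 * (-(ε / 2) * (1 + s)⁻¹) ^ 2 * s)) =
        -(K * ε * (s / (1 + s))) := by
      field_simp
      ring
    rw [e1] at h'
    refine h'.trans_eq ?_
    field_simp
    ring
  have hr : s / (1 + s) = 1 - 1 / (1 + s) := by field_simp; ring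
  have hr1 : s / (1 + s) ≤ 1 := by rw [div_le_one hs1]; linarith
  have h1 : K * ε * (s / (1 + s)) ≤ K * ε := mul_le_of_le_one_right (by positivity) hr1
  have h2 : -(1 / p) * (2 * (p - 1) * (s / (1 + s)) - (N + p - 2)) =
      2 * (p - 1) / (p * (1 + s)) - (1 - N / p) := by
    rw [hr]; field_simp; ring
  linarith

/-- Under the drift condition a supersolution bounded from below attains its infimum. -/
lemma IsViscositySupersolutionNormPLap.exists_forall_le
    (hu : IsViscositySupersolutionNormPLap p b A γ u) (hp : 1 < p)
    (hK0 : 0 ≤ K) (hK : ∀ r : ℝ, 0 ≤ r → -(K * r ^ 2) ≤ A * r ^ γ)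
    (hbdd : BddBelow (Set.range u)) {d : ℝ} (hd : d < 1 - N / p)
    (hb : ∀ᶠ x in Bornology.cobounded (EuclideanSpace ℝ (Fin N)), inner ℝ (b x) x ≤ d) :
    ∃ x₀, ∀ x, u x₀ ≤ u x := by
  -- Half of the gap absorbs the decaying term, the other half the gradient term `K ε`.
  obtain ⟨c, hc⟩ : ∃ c, c = (1 - N / p - d) / 2 := ⟨_, rfl⟩
  have hc0 : 0 < c := by linarith
  have hp0 : 0 < p := by linarith
  have htend : Filter.Tendsto
      (fun x : EuclideanSpace ℝ (Fin N) => 1 + ‖x‖ ^ 2) (Bornology.cobounded _) Filter.atTop :=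
    Filter.tendsto_atTop_add_const_left _ _
      ((Filter.tendsto_pow_atTop two_ne_zero).comp tendsto_norm_cobounded_atTop)
  have hsmall : ∀ᶠ x in Bornology.cobounded (EuclideanSpace ℝ (Fin N)),
      2 * (p - 1) / (p * (1 + ‖x‖ ^ 2)) ≤ c := by
    filter_upwards [htend.eventually_ge_atTop (2 * (p - 1) / (p * c))] with x hx
    rw [div_le_iff₀ (by positivity)] at hx ⊢
    linarith
  obtain ⟨R, hR0, hR⟩ : ∃ R : ℝ, 0 ≤ R ∧ ∀ x : EuclideanSpace ℝ (Fin N), R < ‖x‖ →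
      inner ℝ (b x) x + 2 * (p - 1) / (p * (1 + ‖x‖ ^ 2)) ≤ 1 - N / p - c := by
    have h := hb.and hsmall
    rw [← comap_norm_atTop, Filter.eventually_comap] at h
    obtain ⟨R, hR⟩ := Filter.eventually_atTop.1 h
    refine ⟨max R 0, le_max_right _ _, fun x hx => ?_⟩
    obtain ⟨h1, h2⟩ := hR ‖x‖ ((le_max_left _ _).trans hx.le) x rfl
    linarith
  obtain ⟨x₀, -, hx₀⟩ := (hu.lowerSemicontinuous.lowerSemicontinuousOn _).exists_isMinOn
    (⟨0, Metric.mem_closedBall_self hR0⟩ : (Metric.closedBall (0 : EuclideanSpace ℝ (Fin N)) R).Nonempty)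
    (isCompact_closedBall _ _)
  refine ⟨x₀, fun x => ?_⟩
  obtain ⟨m, hm⟩ := hbdd
  have hm : ∀ y, m ≤ u y := fun y => hm ⟨y, rfl⟩
  have hlog : ∀ y : EuclideanSpace ℝ (Fin N), 0 ≤ Real.log (1 + ‖y‖ ^ 2) := fun y =>
    Real.log_nonneg (by nlinarith [sq_nonneg ‖y‖])
  have hcont : Continuous fun y : EuclideanSpace ℝ (Fin N) => Real.log (1 + ‖y‖ ^ 2) :=
    Continuous.log (by fun_prop) fun y => by positivity
  have main : ∀ ε : ℝ, 0 < ε → K * ε < c →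
      u x₀ ≤ u x + ε / 2 * Real.log (1 + ‖x‖ ^ 2) := by
    intro ε hε hεK
    obtain ⟨w, hw⟩ : ∃ w : EuclideanSpace ℝ (Fin N) → ℝ,
      w = fun y => u y - -(ε / 2) * Real.log (1 + ‖y‖ ^ 2) := ⟨_, rfl⟩
    have hwv : ∀ y, w y = u y + ε / 2 * Real.log (1 + ‖y‖ ^ 2) := fun y => by rw [hw]; ring
    have hwl : LowerSemicontinuous w := by
      have : w = fun y => u y + ε / 2 * Real.log (1 + ‖y‖ ^ 2) := funext hwv
      rw [this]
      exact hu.lowerSemicontinuous.add (hcont.const_mul (ε / 2)).lowerSemicontinuous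
    have hlim : Filter.Tendsto (fun r : ℝ => m + ε / 2 * Real.log (1 + r ^ 2))
        Filter.atTop Filter.atTop :=
      Filter.tendsto_atTop_add_const_left _ _ <| Filter.Tendsto.const_mul_atTop (by positivity) <|
        Real.tendsto_log_atTop.comp <| Filter.tendsto_atTop_add_const_left _ _ <|
          Filter.tendsto_pow_atTop two_ne_zero
    -- The logarithm beats the lower bound `m`: `w` exceeds `w x` on the sphere of radius `R₁`, so a
    -- minimizer over the ball is interior.
    obtain ⟨R₁, hR₁, hxR₁⟩ :=
      ((hlim.eventually_gt_atTop (w x)).and (Filter.eventually_ge_atTop ‖x‖)).exists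
    obtain ⟨y, hy, hymin⟩ := (hwl.lowerSemicontinuousOn _).exists_isMinOn
      (⟨x, by simpa using hxR₁⟩ : (Metric.closedBall (0 : EuclideanSpace ℝ (Fin N)) R₁).Nonempty)
      (isCompact_closedBall _ _)
    have hyx : w y ≤ w x := hymin (by simpa using hxR₁)
    rw [mem_closedBall_zero_iff] at hy
    rw [← hwv]
    by_cases hyR : ‖y‖ ≤ R
    · have h1 : u x₀ ≤ u y := hx₀ (by simpa using hyR)
      have h2 := hwv y
      have h3 := mul_nonneg (half_pos hε).le (hlog y)
      linarith
    · push Not at hyR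
      exfalso
      rcases hy.lt_or_eq with hlt | heq
      · have hloc : IsLocalMin w y := hymin.isLocalMin
          (Filter.mem_of_superset (Metric.isOpen_ball.mem_nhds (by simpa using hlt))
            Metric.ball_subset_closedBall)
        rw [hw] at hloc
        exact hu.not_isLocalMin_add_log hp hK0 hK hε hεK
          (norm_pos_iff.1 (hR0.trans_lt hyR)) (hR y hyR) hloc
      · have h2 := hwv y
        rw [heq] at h2
        linarith [hm y]
  have hlim : Filter.Tendsto (fun ε : ℝ => u x + ε / 2 * Real.log (1 + ‖x‖ ^ 2))
      (nhdsWithin 0 (Set.Ioi 0)) (nhds (u x)) := by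
    have : Continuous fun ε : ℝ => u x + ε / 2 * Real.log (1 + ‖x‖ ^ 2) := by fun_prop
    simpa using (this.tendsto 0).mono_left nhdsWithin_le_nhds
  have hlimK : Filter.Tendsto (fun ε : ℝ => K * ε) (nhdsWithin 0 (Set.Ioi 0)) (nhds 0) := by
    have : Continuous fun ε : ℝ => K * ε := by fun_prop
    simpa using (this.tendsto 0).mono_left nhdsWithin_le_nhds
  refine ge_of_tendsto hlim ?_
  filter_upwards [self_mem_nhdsWithin, hlimK.eventually_lt_const hc0] with ε h1 h2
  exact main ε h1 h2

/-! ### Strong minimum principle: Hopf barrier. -/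

/-- Away from the centre, large `α` lets the radial second derivative dominate drift and first-order
terms; then small `δ` bounds the quadratic term. -/
lemma IsViscositySupersolutionNormPLap.not_isLocalMin_sub_exp
    (hu : IsViscositySupersolutionNormPLap p b A γ u) (hp : 1 < p)
    (hK0 : 0 ≤ K) (hK : ∀ r : ℝ, 0 ≤ r → -(K * r ^ 2) ≤ A * r ^ γ)
    {α δ : ℝ} (hα : 0 < α) (hδ : 0 < δ) {x y : EuclideanSpace ℝ (Fin N)} (hxy : x ≠ y)
    (hδK : 2 * K * δ * α * ‖x - y‖ ^ 2 ≤ 1)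
    (hb : inner ℝ (b x) (x - y) + (N + p - 2) / p + 1 <
      2 * (p - 1) / p * α * ‖x - y‖ ^ 2) :
    ¬ IsLocalMin (fun x => u x - δ * Real.exp (-α * ‖x - y‖ ^ 2)) x := by
  intro hmin
  have hexp : ∀ s : ℝ, HasDerivAt (fun s => Real.exp (-α * s)) (-α * Real.exp (-α * s)) s := by
    intro s
    have h := ((hasDerivAt_id s).const_mul (-α)).exp
    refine h.congr_deriv ?_
    simp
    ring
  have hf : ∀ s : ℝ, 0 ≤ s →
      HasDerivAt (fun s => δ * Real.exp (-α * s)) (δ * (-α * Real.exp (-α * s))) s :=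
    fun s _ => (hexp s).const_mul δ
  have hf₁ : ∀ s : ℝ, 0 ≤ s → HasDerivAt (fun s => δ * (-α * Real.exp (-α * s)))
      (δ * (-α * (-α * Real.exp (-α * s)))) s :=
    fun s _ => ((hexp s).const_mul (-α)).const_mul δ
  have hC : ContDiff ℝ 2 fun x : EuclideanSpace ℝ (Fin N) =>
      δ * Real.exp (-α * ‖x - y‖ ^ 2) :=
    contDiff_const.mul (contDiff_const.mul ((contDiff_id.sub contDiff_const).norm_sq ℝ)).exp
  have h := hu.radial_test (x := x) (y := y) hK hf hf₁ hC hxy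
    (mul_ne_zero hδ.ne' (mul_ne_zero (neg_ne_zero.2 hα.ne') (Real.exp_ne_zero _))) hmin
  set s := ‖x - y‖ ^ 2
  have hs : 0 ≤ s := sq_nonneg _
  have hp0 : 0 < p := by linarith
  have he : 0 < Real.exp (-α * s) := Real.exp_pos _
  have he1 : Real.exp (-α * s) ≤ 1 := Real.exp_le_one_iff.2 (by nlinarith)
  set e := Real.exp (-α * s)
  have key : -(2 * K * δ * α * s * e) ≤
      -(2 * (p - 1) / p * α * s) + (N + p - 2) / p + inner ℝ (b x) (x - y) := by
    have h' := mul_le_mul_of_nonneg_left h (by positivity : 0 ≤ 1 / (2 * δ * α * e))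
    have e1 : 1 / (2 * δ * α * e) * -(K * (4 * (δ * (-α * e)) ^ 2 * s)) =
        -(2 * K * δ * α * s * e) := by
      field_simp
      ring
    rw [e1] at h'
    refine h'.trans_eq ?_
    field_simp
    ring
  have h1 : 2 * K * δ * α * s * e ≤ 2 * K * δ * α * s :=
    mul_le_of_le_one_right (by positivity) he1
  linarith

/-- The strong minimum principle. -/
lemma IsViscositySupersolutionNormPLap.eq_of_forall_le
    (hu : IsViscositySupersolutionNormPLap p b A γ u) (hp : 1 < p)
    (hK0 : 0 ≤ K) (hK : ∀ r : ℝ, 0 ≤ r → -(K * r ^ 2) ≤ A * r ^ γ)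
    (hb : Continuous b) {x₀ : EuclideanSpace ℝ (Fin N)} (hx₀ : ∀ x, u x₀ ≤ u x)
    (y : EuclideanSpace ℝ (Fin N)) : u y = u x₀ := by
  by_contra hy
  obtain ⟨M, hM⟩ : ∃ M : Set (EuclideanSpace ℝ (Fin N)), M = u ⁻¹' Set.Iic (u x₀) := ⟨_, rfl⟩
  have hMclosed : IsClosed M := hM ▸ hu.lowerSemicontinuous.isClosed_preimage _
  have hMne : M.Nonempty := ⟨x₀, by simp [hM]⟩
  have hyM : y ∉ M := fun h => hy (le_antisymm (by simpa [hM] using h) (hx₀ y))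
  -- The open ball about `y` through this nearest point misses the minimum set.
  obtain ⟨z, hzM, hz⟩ := hMclosed.exists_infDist_eq_dist hMne y
  obtain ⟨ρ, hρ⟩ : ∃ ρ, ρ = ‖z - y‖ := ⟨_, rfl⟩
  have hρ0 : 0 < ρ := by
    rw [hρ, norm_pos_iff, sub_ne_zero]
    rintro rfl
    exact hyM hzM
  have hin : ∀ x, ‖x - y‖ < ρ → u x₀ < u x := by
    intro x hx
    by_contra hcon
    have : Metric.infDist y M ≤ dist y x :=
      Metric.infDist_le_dist_of_mem (by simpa [hM] using hcon)
    rw [hz, dist_comm y z, dist_comm y x, dist_eq_norm, dist_eq_norm, ← hρ] at this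
    linarith
  have huz : u z = u x₀ := le_antisymm (by simpa [hM] using hzM) (hx₀ z)
  -- a positive gap on the inner ball
  obtain ⟨η, hη0, hη⟩ : ∃ η > 0, ∀ x, ‖x - y‖ ≤ ρ / 2 → u x₀ + η ≤ u x := by
    obtain ⟨x₁, hx₁, hx₁min⟩ := (hu.lowerSemicontinuous.lowerSemicontinuousOn _).exists_isMinOn
      (⟨y, Metric.mem_closedBall_self (by positivity)⟩ : (Metric.closedBall y (ρ / 2)).Nonempty)
      (isCompact_closedBall _ _)
    rw [mem_closedBall_iff_norm] at hx₁
    refine ⟨u x₁ - u x₀, sub_pos.2 (hin x₁ (by linarith)), fun x hx => ?_⟩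
    have : u x₁ ≤ u x := hx₁min (mem_closedBall_iff_norm.2 hx)
    linarith
  obtain ⟨B, hB⟩ := (isCompact_closedBall y ρ).exists_bound_of_continuousOn
    (f := fun x => (inner ℝ (b x) (x - y) : ℝ)) (by fun_prop)
  have hp0 : 0 < p := by linarith
  have hq : 0 < 2 * (p - 1) / p * (ρ / 2) ^ 2 := by
    have : 0 < p - 1 := by linarith
    positivity
  obtain ⟨α, hα0, hα⟩ : ∃ α > 0,
      B + (N + p - 2) / p + 1 < α * (2 * (p - 1) / p * (ρ / 2) ^ 2) := by
    refine ((Filter.eventually_gt_atTop 0).and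
      ((Filter.tendsto_id.atTop_mul_const hq).eventually_gt_atTop _)).exists
  obtain ⟨δ, hδ0, hδη, hδK⟩ : ∃ δ > 0, δ < η ∧ 2 * K * δ * α * ρ ^ 2 < 1 := by
    have h1 : Filter.Tendsto (fun δ : ℝ => 2 * K * δ * α * ρ ^ 2) (nhdsWithin 0 (Set.Ioi 0))
        (nhds 0) := by
      have : Continuous fun δ : ℝ => 2 * K * δ * α * ρ ^ 2 := by fun_prop
      simpa using (this.tendsto 0).mono_left nhdsWithin_le_nhds
    have h2 : ∀ᶠ δ : ℝ in nhdsWithin 0 (Set.Ioi 0), δ < η :=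
      (Filter.tendsto_id.mono_left nhdsWithin_le_nhds).eventually_lt_const hη0
    obtain ⟨δ, hδ⟩ := ((eventually_mem_nhdsWithin (a := (0 : ℝ)) (s := Set.Ioi 0)).and
      (h2.and (h1.eventually_lt_const one_pos))).exists
    exact ⟨δ, hδ.1, hδ.2⟩
  have hnot : ∀ x, ρ / 2 < ‖x - y‖ → ‖x - y‖ ≤ ρ →
      ¬ IsLocalMin (fun x => u x - δ * Real.exp (-α * ‖x - y‖ ^ 2)) x := by
    intro x h1 h2
    have hsq1 : (ρ / 2) ^ 2 ≤ ‖x - y‖ ^ 2 := by gcongr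
    have hsq2 : ‖x - y‖ ^ 2 ≤ ρ ^ 2 := by gcongr
    refine hu.not_isLocalMin_sub_exp hp hK0 hK hα0 hδ0
      (fun h => by rw [h, sub_self, norm_zero] at h1; linarith) ?_ ?_
    · have := mul_le_mul_of_nonneg_left hsq2 (by positivity : 0 ≤ 2 * K * δ * α)
      linarith
    · have h3 := (le_abs_self _).trans (hB x (mem_closedBall_iff_norm.2 h2))
      have hp1 : 0 < p - 1 := by linarith
      have h4 := mul_le_mul_of_nonneg_left hsq1 (by positivity : 0 ≤ 2 * (p - 1) / p * α)
      linarith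
  obtain ⟨g, hg⟩ : ∃ g : EuclideanSpace ℝ (Fin N) → ℝ,
      g = fun x => u x - δ * Real.exp (-α * ‖x - y‖ ^ 2) := ⟨_, rfl⟩
  rw [← hg] at hnot
  have hgl : LowerSemicontinuous g := by
    have : g = fun x => u x + -(δ * Real.exp (-α * ‖x - y‖ ^ 2)) := by
      rw [hg]; ext x; ring
    rw [this]
    exact hu.lowerSemicontinuous.add (Continuous.lowerSemicontinuous (by fun_prop))
  have hzball : z ∈ Metric.closedBall y ρ := mem_closedBall_iff_norm.2 hρ.ge
  obtain ⟨w, hw, hwmin⟩ := (hgl.lowerSemicontinuousOn _).exists_isMinOn ⟨z, hzball⟩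
    (isCompact_closedBall y ρ)
  rw [mem_closedBall_iff_norm] at hw
  have hwz : g w ≤ g z := hwmin hzball
  have hgz : g z = u x₀ - δ * Real.exp (-α * ρ ^ 2) := by rw [hg, hρ, ← huz]
  -- Near the centre the gap `η > δ` keeps `g` above `u x₀`, whereas `g z < u x₀`.
  have hw2 : ρ / 2 < ‖w - y‖ := by
    by_contra hcon
    have h1 := hη w (not_lt.1 hcon)
    have h2 : Real.exp (-α * ‖w - y‖ ^ 2) ≤ 1 :=
      Real.exp_le_one_iff.2 (by nlinarith [mul_nonneg hα0.le (sq_nonneg ‖w - y‖)])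
    have h3 : δ * Real.exp (-α * ‖w - y‖ ^ 2) ≤ δ := mul_le_of_le_one_right hδ0.le h2
    have h4 : 0 < δ * Real.exp (-α * ρ ^ 2) := mul_pos hδ0 (Real.exp_pos _)
    have h5 : g w = u w - δ * Real.exp (-α * ‖w - y‖ ^ 2) := by rw [hg]
    linarith
  refine hnot w hw2 hw ?_
  rcases hw.lt_or_eq with hlt | heq
  · exact hwmin.isLocalMin (Filter.mem_of_superset
      (Metric.isOpen_ball.mem_nhds (mem_ball_iff_norm.2 hlt)) Metric.ball_subset_closedBall)
  -- A minimizer on the sphere is a global one: outside the ball `u ≥ u x₀` and the barrier is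
  -- smaller than on the sphere.
  · refine Filter.Eventually.of_forall fun x => ?_
    rcases le_total ‖x - y‖ ρ with h | h
    · exact hwmin (mem_closedBall_iff_norm.2 h)
    · refine hwz.trans (hgz.trans_le ?_)
      have h1 : Real.exp (-α * ‖x - y‖ ^ 2) ≤ Real.exp (-α * ρ ^ 2) := by
        have : ρ ^ 2 ≤ ‖x - y‖ ^ 2 := by gcongr
        exact Real.exp_le_exp.2 (by nlinarith)
      have h2 := mul_le_mul_of_nonneg_left h1 hδ0.le
      have h3 : g x = u x - δ * Real.exp (-α * ‖x - y‖ ^ 2) := by rw [hg]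
      linarith [hx₀ x]

end Liouville

theorem mainTheorem8 (N : ℕ) (hN : 1 ≤ N) (p : ℝ) (hp : 1 < p) (A γ : ℝ)
    (hAγ : (0 < A ∧ 0 < γ) ∨ γ = 2)
    (b : EuclideanSpace ℝ (Fin N) → EuclideanSpace ℝ (Fin N))
    (hb : ∀ R : ℝ, 0 < R →
      ∃ K : ℝ≥0, LipschitzOnWith K b (Metric.closedBall (0 : EuclideanSpace ℝ (Fin N)) R))
    (hdrift : Filter.limsup (fun x : EuclideanSpace ℝ (Fin N) => ((inner ℝ (b x) x : ℝ) : EReal))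
        (Bornology.cobounded (EuclideanSpace ℝ (Fin N))) <
      (((if 2 < p then 1 - (N : ℝ) * (p - 1) / p else 1 - (N : ℝ) / p) : ℝ) : EReal))
    (u : EuclideanSpace ℝ (Fin N) → ℝ)
    (hu : IsViscositySupersolutionNormPLap p b A γ u)
    (hbdd : BddBelow (Set.range u)) :
    ∃ c : ℝ, ∀ x : EuclideanSpace ℝ (Fin N), u x = c := by
  have hK : ∀ r : ℝ, 0 ≤ r → -(|A| * r ^ 2) ≤ A * r ^ γ := by
    intro r hr
    rcases hAγ with ⟨hA, -⟩ | rfl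
    · have h1 : 0 ≤ A * r ^ γ := mul_nonneg hA.le (Real.rpow_nonneg hr γ)
      have h2 : 0 ≤ |A| * r ^ 2 := by positivity
      linarith
    · rw [Real.rpow_two, ← neg_mul]
      exact mul_le_mul_of_nonneg_right (neg_abs_le A) (sq_nonneg r)
  have hcont : Continuous b := by
    refine continuous_iff_continuousAt.2 fun x => ?_
    obtain ⟨L, hL⟩ := hb (‖x‖ + 1) (by positivity)
    exact hL.continuousOn.continuousAt (Filter.mem_of_superset
      (Metric.isOpen_ball.mem_nhds (by simp)) Metric.ball_subset_closedBall)
  -- Radial barriers need only the threshold `1 - N/p`, which for `p > 2` is weaker than the assumed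
  -- one.
  have hle : (if 2 < p then 1 - (N : ℝ) * (p - 1) / p else 1 - (N : ℝ) / p) ≤ 1 - N / p := by
    split_ifs with h
    · have hp0 : 0 < p := by linarith
      have hN0 : (0 : ℝ) ≤ N := N.cast_nonneg
      gcongr
      nlinarith
    · exact le_rfl
  obtain ⟨d, hd1, hd2⟩ := EReal.lt_iff_exists_real_btwn.1 hdrift
  have hev : ∀ᶠ x in Bornology.cobounded (EuclideanSpace ℝ (Fin N)), inner ℝ (b x) x ≤ d := by
    filter_upwards [Filter.eventually_lt_of_limsup_lt hd1] with x hx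
    exact (EReal.coe_lt_coe_iff.1 hx).le
  obtain ⟨x₀, hx₀⟩ := hu.exists_forall_le hp (abs_nonneg A) hK hbdd
    ((EReal.coe_lt_coe_iff.1 hd2).trans_le hle) hev
  exact ⟨u x₀, hu.eq_of_forall_le hp (abs_nonneg A) hK hcont hx₀⟩
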